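/- Let $\mathcal A=(\mathcal A,\preccurlyeq,\to,\mathscr S)$ be an implicative algebra. That is, $(\mathcal A,\preccurlyeq)$ is a complete lattice; the operation $\to$ is antitone in its first and monotone in its second argument and satisfies $a\to\bigwedge B=\bigwedge_{b\in B}(a\to b)$ for all $a\in\mathcal A$, $B\subseteq\mathcal A$; and the separator $\mathscr S\subseteq\mathcal A$ is upward closed, contains $\bigwedge_{a,b}(a\to b\to a)$ and $\bigwedge_{a,b,c}((a\to b\to c)\to(a\to b)\to a\to c)$, and is closed under modus ponens ($a\to b\in\mathscr S$ and $a\in\mathscr S$ imply $b\in\mathscr S$). For $a,b\in\mathcal A$ and $U\subseteq\mathcal A$ put $$a\sqcap b=\bigwedge_{c\in\mathcal A}\bigl((a\to b\to c)\to c\bigr),\qquad \exists U=\bigwedge_{c\in\mathcal A}\Bigl(\bigl(\bigwedge_{u\in U}(u\to c)\bigr)\to c\Bigr).$$ For families $u,v:X\to\mathcal A$ write $u\sqsubseteq_X v$ if $\bigwedge_{x\in X}(u_x\to v_x)\in\mathscr S$, and $u\cong_X v$ if $u\sqsubseteq_X v$ and $v\sqsubseteq_X u$. An assembly is a set $X$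 with a map $\mathsf{ex}_X:X\to\mathscr S$; a morphism $X\to Y$ of assemblies is a map $f:X\to Y$ such that $\bigwedge_{x\in X}\bigl(\mathsf{ex}_X(x)\to\mathsf{ex}_Y(f(x))\bigr)\in\mathscr S$. For $M\subseteq\mathscr S$, let $\mathbf{Asm}_M$ be the full subcategory of the category of assemblies whose objects are the assemblies $X$ with $\mathsf{ex}_X$ valued in $M$. An $M$-valuation of a set $X$ is a map $\nu$ from $X$ to the set of nonempty subsets of $M$, and $\exists\nu$ denotes the family $(\exists\,\nu(x))_{x\in X}$. A subset $M\subseteq\mathscr S$ is called - algebraic if $a\sqcap b\in M$ for all $a,b\in M$; - dense if $M\neq\varnothing$ and there is an $M$-valuation $\nu$ of $\mathscr S$ with $\mathrm{id}_{\mathscr S}\cong_{\mathscr S}\exists\nu$; - compact if for every set $X$, every family $u:X\to M$ and every $M$-valuation $\nu$ of $X$ with $u\sqsubseteq_X\exists\nu$, there is a family $b:X\to M$ with $b_x\in\nu(x)$ for all $x\in X$ and $u\sqsubseteq_X b\sqsubseteq_X\exists\nu$; - a generator of $\mathscr S$ if it is algebraic, dense and compact. **Corollary.** If $M$ and $M'$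 are generators of $\mathscr S$, then the categories $\mathbf{Asm}_M$ and $\mathbf{Asm}_{M'}$ are equivalent. -/

import Mathlib

universe u

/-- An implicative structure on a complete lattice (equivalently, a complete meet-semilattice):
an implication that is antitone in its first argument, monotone in its second one, and commutes
with arbitrary meets (the empty one included) in its second argument. -/
class ImplicativeStructure (A : Type u) [CompleteLattice A] where
  imp : A → A → A
  imp_mono : ∀ {a a' b b' : A}, a' ≤ a → b ≤ b' → imp a b ≤ imp a' b'
  imp_sInf : ∀ (a : A) (B : Set A), imp a (sInf B) = ⨅ b ∈ B, imp a b

namespace ImplicativeStructure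

variable {A : Type u} [CompleteLattice A] [ImplicativeStructure A]

/-- The interpretation of the combinator `K`. -/
def combK (A : Type u) [CompleteLattice A] [ImplicativeStructure A] : A :=
  ⨅ (a : A) (b : A), imp a (imp b a)

/-- The interpretation of the combinator `S`. -/
def combS (A : Type u) [CompleteLattice A] [ImplicativeStructure A] : A :=
  ⨅ (a : A) (b : A) (c : A), imp (imp a (imp b c)) (imp (imp a b) (imp a c))

/-- The product (conjunction): the second-order encoding of pairs. -/
def prod (a b : A) : A := ⨅ c : A, imp (imp a (imp b c)) c

/-- Implicative existence over a subset: the second-order encoding of the existential. -/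
def exist (U : Set A) : A := ⨅ c : A, imp (⨅ a ∈ U, imp a c) c

theorem imp_iInf {ι : Sort*} (a : A) (f : ι → A) : imp a (⨅ i, f i) = ⨅ i, imp a (f i) := by
  rw [← sInf_range, imp_sInf, iInf_range]

end ImplicativeStructure

open ImplicativeStructure in
/-- A separator of an implicative structure. An implicative algebra is an implicative structure
together with a separator. -/
structure Separator (A : Type u) [CompleteLattice A] [ImplicativeStructure A] where
  carrier : Set A
  upward : ∀ {a b : A}, a ∈ carrier → a ≤ b → b ∈ carrier
  combK_mem : combK A ∈ carrier
  combS_mem : combS A ∈ carrier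
  mp : ∀ {a b : A}, imp a b ∈ carrier → a ∈ carrier → b ∈ carrier

namespace Separator

open ImplicativeStructure CategoryTheory

variable {A : Type u} [CompleteLattice A] [ImplicativeStructure A] (S : Separator A)

/-- Entailment `u ⊑_X v` between families indexed by `X` (the order of the fibre over `X` of the
implicative tripos). -/
def Entails {X : Type u} (u v : X → A) : Prop := (⨅ x, imp (u x) (v x)) ∈ S.carrier

/-- Isomorphism `u ≅_X v` in the fibre over `X`. -/
def Equivalent {X : Type u} (u v : X → A) : Prop := S.Entails u v ∧ S.Entails v u

theorem mp_iInf {X : Type u} {p q : X → A} (h : S.Entails p q) (hp : (⨅ x, p x) ∈ S.carrier) :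
    (⨅ x, q x) ∈ S.carrier := by
  refine S.mp (S.upward h ?_) hp
  rw [imp_iInf]
  exact iInf_mono fun x => imp_mono (iInf_le _ x) le_rfl

theorem entails_K {X : Type u} (a b : X → A) : S.Entails a fun x => imp (b x) (a x) :=
  S.upward S.combK_mem (le_iInf fun x => iInf_le_of_le (a x) (iInf_le _ (b x)))

theorem entails_S {X : Type u} (a b c : X → A) :
    S.Entails (fun x => imp (a x) (imp (b x) (c x)))
      fun x => imp (imp (a x) (b x)) (imp (a x) (c x)) :=
  S.upward S.combS_mem
    (le_iInf fun x => iInf_le_of_le (a x) (iInf_le_of_le (b x) (iInf_le _ (c x))))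

theorem entails_refl {X : Type u} (a : X → A) : S.Entails a a :=
  S.mp_iInf (S.mp_iInf (S.entails_S a (fun x => imp (a x) (a x)) a)
    (S.entails_K a fun x => imp (a x) (a x))) (S.entails_K a a)

theorem entails_trans {X : Type u} {a b c : X → A} (h : S.Entails a b) (h' : S.Entails b c) :
    S.Entails a c :=
  S.mp_iInf (S.mp_iInf (S.entails_S a b c)
    (S.mp_iInf (S.entails_K (fun x => imp (b x) (c x)) a) h')) h

theorem entails_comp {X Y : Type u} (f : X → Y) {a b : Y → A} (h : S.Entails a b) :
    S.Entails (fun x => a (f x)) fun x => b (f x) :=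
  S.upward h (le_iInf fun x => iInf_le _ (f x))

/-- An assembly: a set with an existence predicate valued in the separator. -/
structure Assembly where
  carrier : Type u
  ex : carrier → A
  ex_mem : ∀ x, ex x ∈ S.carrier

/-- A morphism of assemblies: a tracked map of the carriers. -/
@[ext]
structure Assembly.Hom (X Y : S.Assembly) where
  toFun : X.carrier → Y.carrier
  tracked : (⨅ x, imp (X.ex x) (Y.ex (toFun x))) ∈ S.carrier

/-- The category of all assemblies over the implicative algebra. -/
instance : Category S.Assembly where
  Hom X Y := Assembly.Hom S X Y
  id X := ⟨id, S.entails_refl X.ex⟩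
  comp f g := ⟨g.toFun ∘ f.toFun, S.entails_trans f.tracked (S.entails_comp f.toFun g.tracked)⟩

/-- The assemblies whose existence predicate is valued in `M`. -/
def valuedIn (M : Set A) : ObjectProperty S.Assembly := fun X => ∀ x, X.ex x ∈ M

/-- The category of `M`-assemblies: the full subcategory of assemblies valued in `M`. -/
abbrev Asm (M : Set A) := (S.valuedIn M).FullSubcategory

/-- An `M`-valuation of `X`: a map from `X` to the nonempty subsets of `M`. -/
structure Valuation (M : Set A) (X : Type u) where
  toFun : X → Set A
  nonempty : ∀ x, (toFun x).Nonempty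
  subset : ∀ x, toFun x ⊆ M

/-- The family of the implicative existences of the values of a valuation. -/
def Valuation.exist {M : Set A} {X : Type u} (ν : Valuation M X) : X → A :=
  fun x => ImplicativeStructure.exist (ν.toFun x)

/-- A subset of the separator is algebraic if it is closed under the product. -/
structure IsAlgebraic (M : Set A) : Prop where
  subset : M ⊆ S.carrier
  prod_mem : ∀ {a b : A}, a ∈ M → b ∈ M → ImplicativeStructure.prod a b ∈ M

/-- Density: the identity family of the separator is isomorphic, in the fibre over the separator,
to the existence of an `M`-valuation. -/
structure IsDense (M : Set A) : Prop where
  subset : M ⊆ S.carrier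
  nonempty : M.Nonempty
  exists_valuation : ∃ ν : Valuation M S.carrier, S.Equivalent (fun s : S.carrier => (s : A)) ν.exist

/-- Compactness. -/
structure IsCompact (M : Set A) : Prop where
  subset : M ⊆ S.carrier
  exists_selection : ∀ (X : Type u) (u : X → A) (ν : Valuation M X), (∀ x, u x ∈ M) →
    S.Entails u ν.exist →
      ∃ b : X → A, (∀ x, b x ∈ M) ∧ (∀ x, b x ∈ ν.toFun x) ∧
        S.Entails u b ∧ S.Entails b ν.exist

/-- A generator of the separator: an algebraic subset that is dense and compact. -/
structure IsGenerator (M : Set A) : Prop where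
  algebraic : S.IsAlgebraic M
  dense : S.IsDense M
  compact : S.IsCompact M

end Separator

namespace ImplicativeStructure

variable {A : Type u} [CompleteLattice A] [ImplicativeStructure A]

/-! Up to isomorphism, generators present the same families. Let `u` be `M`-valued. Density of `M'`
presents each `u x` as the existential of a set of elements `m` of `M'`, and density of `M` presents
each such `m` as the existential of a subset of `M`. The union of these subsets is an `M`-valuation
whose existential `u` entails, so compactness selects from it a family `b` with `u ⊑ b`. Each `b x`
comes from some `m x` in `M'`, and `u ⊑ b ⊑ m ⊑ u` (`IsCompact.exists_equivalent`). Thus `M`- and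
`M'`-assemblies have the same isomorphism closure among all assemblies, and each full subcategory is
equivalent to its closure. -/

theorem exist_mono {U V : Set A} (h : U ⊆ V) : exist U ≤ exist V :=
  iInf_mono fun _ => imp_mono (biInf_mono h) le_rfl

end ImplicativeStructure

namespace Separator

open ImplicativeStructure CategoryTheory

variable {A : Type u} [CompleteLattice A] [ImplicativeStructure A] (S : Separator A)

/-- Evaluation at a realizer `t` common to all `q x`: the combinator `S I (K t)`. -/
theorem entails_imp_of_mem {X : Type u} {q v : X → A} (hq : (⨅ x, q x) ∈ S.carrier) :
    S.Entails (fun x => imp (q x) (v x)) v :=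
  S.mp_iInf
    (S.mp_iInf (S.entails_S (fun x => imp (q x) (v x)) q v)
      (S.entails_refl fun x => imp (q x) (v x)))
    (S.mp_iInf (S.entails_K q fun x => imp (q x) (v x)) hq)

theorem entails_imp_imp {X : Type u} (a c : X → A) :
    S.Entails a fun x => imp (imp (a x) (c x)) (c x) :=
  S.entails_trans (S.entails_K a fun x => imp (a x) (c x))
    (S.mp_iInf (S.entails_S (fun x => imp (a x) (c x)) a c)
      (S.entails_refl fun x => imp (a x) (c x)))

/-- Introduction rule for the implicative existential. -/
theorem entails_exist {X : Type u} {b : X → A} {U : X → Set A} (hb : ∀ x, b x ∈ U x) :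
    S.Entails b fun x => exist (U x) := by
  -- Indexing by `X × A` gives a single realizer uniform in both `x` and the bound variable `c` of
  -- the existential.
  refine S.upward
    (S.entails_imp_imp (fun p : X × A => b p.1) fun p : X × A => p.2) (le_iInf fun x => ?_)
  simp only [exist, imp_iInf]
  exact le_iInf fun c => iInf_le_of_le (x, c)
    (imp_mono le_rfl (imp_mono (iInf₂_le (b x) (hb x)) le_rfl))

/-- Elimination rule for the implicative existential. -/
theorem exist_entails {X : Type u} {U : X → Set A} {v : X → A}
    (h : (⨅ x, ⨅ a ∈ U x, imp a (v x)) ∈ S.carrier) :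
    S.Entails (fun x => exist (U x)) v :=
  S.entails_trans
    (S.upward (S.entails_refl fun x => exist (U x))
      (iInf_mono fun x => imp_mono le_rfl (iInf_le _ (v x))))
    (S.entails_imp_of_mem h)

variable {S}

/-- A family valued in a compact dense subset is isomorphic to a family valued in any other
dense subset. -/
theorem IsCompact.exists_equivalent {M M' : Set A} (hc : S.IsCompact M) (hd : S.IsDense M)
    (hd' : S.IsDense M') {X : Type u} {u : X → A} (hu : ∀ x, u x ∈ M) :
    ∃ v : X → A, (∀ x, v x ∈ M') ∧ S.Equivalent u v := by
  obtain ⟨ν, hν⟩ := hd.exists_valuation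
  obtain ⟨ν', hν'⟩ := hd'.exists_valuation
  let s : X → S.carrier := fun x => ⟨u x, hc.subset (hu x)⟩
  -- Composite valuation: the union of `ν m` over `m ∈ ν' (u x)`.
  let U : X → Set A := fun x => {a | ∃ m : S.carrier, (m : A) ∈ ν'.toFun (s x) ∧ a ∈ ν.toFun m}
  let ξ : Valuation M X :=
    { toFun := U
      nonempty := fun x => by
        obtain ⟨m, hm⟩ := ν'.nonempty (s x)
        obtain ⟨a, ha⟩ := ν.nonempty ⟨m, hd'.subset (ν'.subset _ hm)⟩
        exact ⟨a, _, hm, ha⟩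
      subset := fun _ _ ⟨m, _, ha⟩ => ν.subset m ha }
  have huξ : S.Entails u ξ.exist := by
    refine S.entails_trans (S.entails_comp s hν'.1) (S.exist_entails ?_)
    -- The realizer of `id ⊑ ∃ν` is uniform over the whole separator, so it serves every `m` at
    -- once.
    refine S.upward hν.1 (le_iInf fun x => le_iInf₂ fun m hm => ?_)
    exact iInf_le_of_le ⟨m, hd'.subset (ν'.subset _ hm)⟩
      (imp_mono le_rfl (exist_mono fun a ha => ⟨_, hm, ha⟩))
  obtain ⟨b, -, hb, hub, -⟩ := hc.exists_selection X u ξ hu huξ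
  -- The intermediate elements `m x`, which lie in `M'`, form the required family.
  choose m hm hbm using hb
  refine ⟨fun x => m x, fun x => ν'.subset _ (hm x), ?_, ?_⟩
  · exact S.entails_trans hub (S.entails_trans (S.entails_exist hbm) (S.entails_comp m hν.2))
  · exact S.entails_trans (S.entails_exist hm) (S.entails_comp s hν'.2)

/-- Assemblies on the same set with isomorphic existence predicates are isomorphic. -/
def Assembly.isoOfEquivalent (X : S.Assembly) {v : X.carrier → A} (hv : ∀ x, v x ∈ S.carrier)
    (h : S.Equivalent X.ex v) : X ≅ ⟨X.carrier, v, hv⟩ where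
  hom := ⟨id, h.1⟩
  inv := ⟨id, h.2⟩
  hom_inv_id := rfl
  inv_hom_id := rfl

theorem valuedIn_le_isoClosure {M M' : Set A} (hc : S.IsCompact M) (hd : S.IsDense M)
    (hd' : S.IsDense M') : S.valuedIn M ≤ (S.valuedIn M').isoClosure := fun X hX => by
  obtain ⟨v, hv, h⟩ := hc.exists_equivalent hd hd' hX
  exact ⟨⟨X.carrier, v, fun x => hd'.subset (hv x)⟩, hv, ⟨X.isoOfEquivalent (fun x => hd'.subset (hv x)) h⟩⟩

theorem isoClosure_valuedIn_eq {M M' : Set A} (hM : S.IsGenerator M) (hM' : S.IsGenerator M') :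
    (S.valuedIn M).isoClosure = (S.valuedIn M').isoClosure :=
  le_antisymm
    ((ObjectProperty.isoClosure_le_iff _ _).2
      (valuedIn_le_isoClosure hM.compact hM.dense hM'.dense))
    ((ObjectProperty.isoClosure_le_iff _ _).2
      (valuedIn_le_isoClosure hM'.compact hM'.dense hM.dense))

end Separator

theorem mainTheorem9 {A : Type u} [CompleteLattice A] [ImplicativeStructure A]
    (S : Separator A) (M M' : Set A) (hM : S.IsGenerator M) (hM' : S.IsGenerator M') :
    Nonempty (CategoryTheory.Equivalence (S.Asm M) (S.Asm M')) := by
  -- The inclusion into the isomorphism closure is fully faithful and essentially surjective.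
  have e := (CategoryTheory.ObjectProperty.ιOfLE
    (S.valuedIn M).le_isoClosure).asEquivalence
  rw [Separator.isoClosure_valuedIn_eq hM hM'] at e
  exact ⟨e.trans (CategoryTheory.ObjectProperty.ιOfLE
    (S.valuedIn M').le_isoClosure).asEquivalence.symm⟩
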